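/- Let $\mu$ be a nonnegative Borel measure on $\mathbb{R}$ whose support is infinite and all of whose moments are finite (for instance a measure carried by a bounded or unbounded interval $\mathcal{D}$). Put $\langle f,g\rangle_\mu=\int fg\,d\mu$ and $\|f\|_\mu=\langle f,f\rangle_\mu^{1/2}$. Let $p_k$ $(k\ge 0)$ be the monic orthogonal polynomials of $\mu$, i.e. $p_k$ is monic of degree $k$ and $\langle x^j,p_k\rangle_\mu=0$ for $0\le j<k$, and let $$\alpha_k=\frac{\langle xp_k,p_k\rangle_\mu}{\langle p_k,p_k\rangle_\mu}\ (k\ge0),\qquad \beta_0=\langle p_0,p_0\rangle_\mu,\qquad \beta_k=\frac{\langle p_k,p_k\rangle_\mu}{\langle p_{k-1},p_{k-1}\rangle_\mu}\ (k\ge 1).$$ Let $m\ge1$, let $J_m$ be the symmetric tridiagonal matrix of order $m$ with diagonal $\alpha_0,\dots,\alpha_{m-1}$ and off-diagonal entries $\sqrt{\beta_1},\dots,\sqrt{\beta_{m-1}}$, and let $$J^*_{m+1}=\begin{bmatrix} J_m & \sqrt{\beta_m+\beta_{m+1}}\,e_m\\ \sqrt{\beta_m+\beta_{m+1}}\,e_m^T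 & \alpha_m\end{bmatrix},\qquad e_m=[0,\dots,0,1]^T\in\mathbb{R}^m.$$ Let $x_1^*\le\dots\le x_{m+1}^*$ be the eigenvalues of $J^*_{m+1}$, for each $k$ let $v_k$ be any normalized real eigenvector of $J^*_{m+1}$ for $x_k^*$, with first component $v_{k,1}$, let $\lambda_k^*=\beta_0v_{k,1}^2$, and let $G^*_{m+1}(f)=\sum_{k=1}^{m+1}\lambda^*_kf(x^*_k)$. Then: 1. $G^*_{m+1}$ has degree of exactness at least $2m-1$: $G^*_{m+1}(f)=\int f\,d\mu$ for every real polynomial $f$ of degree at most $2m-1$. 2. The nodes interlace with the Gauss nodes: $p_m$ has exactly $m$ distinct real zeros $x_1<\dots<x_m$, and $x_1^*<x_1<x_2^*<x_2<\dots<x_m<x_{m+1}^*$. 3. For $k=1,\dots,m+1$, $$\lambda_k^*=\frac{\beta_m+\beta_{m+1}}{\beta_m}\,\frac{\|p_m\|_\mu^2}{q_{2m+1}'(x_k^*)}>0,\qquad\text{where } q_{2m+1}=p_m\,p^*_{m+1},\quad p^*_{m+1}(x)=\prod_{k=1}^{m+1}(x-x_k^*).$$ -/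

import Mathlib

open MeasureTheory Polynomial Matrix

namespace AveragedGauss

/-- The inner product `⟨f, g⟩_μ = ∫ f g dμ` on real polynomials. -/
noncomputable def polyInner (μ : Measure ℝ) (f g : ℝ[X]) : ℝ :=
  ∫ x, f.eval x * g.eval x ∂μ

/-- The induced norm `‖f‖_μ = ⟨f, f⟩_μ ^ (1/2)`. -/
noncomputable def polyNorm (μ : Measure ℝ) (f : ℝ[X]) : ℝ :=
  Real.sqrt (polyInner μ f f)

/-- The monic orthogonal polynomials `p_k` of the measure `μ`, obtained by orthogonalizing the
monomials. The theorem `eq_orthoPoly_iff` below shows that `p_k` is the only monic polynomial of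
degree `k` that is orthogonal to `1, x, …, x^(k-1)`. -/
noncomputable def orthoPoly (μ : Measure ℝ) (k : ℕ) : ℝ[X] :=
  X ^ k - ∑ j : Fin k,
    C (polyInner μ (X ^ k) (orthoPoly μ j) / polyInner μ (orthoPoly μ j) (orthoPoly μ j)) *
      orthoPoly μ j
termination_by k
decreasing_by all_goals exact j.isLt

/-- Recursion coefficients `α_k = ⟨x p_k, p_k⟩ / ⟨p_k, p_k⟩`. -/
noncomputable def alpha (μ : Measure ℝ) (k : ℕ) : ℝ :=
  polyInner μ (X * orthoPoly μ k) (orthoPoly μ k) / polyInner μ (orthoPoly μ k) (orthoPoly μ k)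

/-- Recursion coefficients `β_0 = ⟨p_0, p_0⟩` and `β_k = ⟨p_k, p_k⟩ / ⟨p_{k-1}, p_{k-1}⟩` for
`k ≥ 1`. -/
noncomputable def beta (μ : Measure ℝ) : ℕ → ℝ
  | 0 => polyInner μ (orthoPoly μ 0) (orthoPoly μ 0)
  | k + 1 => polyInner μ (orthoPoly μ (k + 1)) (orthoPoly μ (k + 1)) /
      polyInner μ (orthoPoly μ k) (orthoPoly μ k)

/-- The symmetric tridiagonal matrix of order `n` with diagonal `a 0, …, a (n-1)` and
off-diagonal `b 1, …, b (n-1)`; the entry `b k` couples the (zero-based) indices `k - 1` and `k`. -/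
def tridiag (n : ℕ) (a b : ℕ → ℝ) : Matrix (Fin n) (Fin n) ℝ :=
  Matrix.of fun i j =>
    if i = j then a i
    else if (i : ℕ) + 1 = j then b j
    else if (j : ℕ) + 1 = i then b i
    else 0

theorem tridiag_isHermitian (n : ℕ) (a b : ℕ → ℝ) : (tridiag n a b).IsHermitian := by
  ext i j
  simp only [tridiag, Matrix.conjTranspose_apply, Matrix.of_apply, star_trivial]
  by_cases h : i = j
  · subst h; rfl
  · rw [if_neg h, if_neg (Ne.symm h)]
    split_ifs <;> first | rfl | omega

/-- The matrix `J*_{m+1}`: its leading block of order `m` is the Jacobi matrix `J_m` (diagonal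
`α_0, …, α_{m-1}`, off-diagonal `√β_1, …, √β_{m-1}`), it is bordered by the off-diagonal entry
`√(β_m + β_{m+1})`, and its last diagonal entry is `α_m`. -/
noncomputable def Jstar (μ : Measure ℝ) (m : ℕ) : Matrix (Fin (m + 1)) (Fin (m + 1)) ℝ :=
  tridiag (m + 1) (alpha μ) fun k =>
    if k = m then Real.sqrt (beta μ m + beta μ (m + 1)) else Real.sqrt (beta μ k)

/-- The nodes `x*_1 ≤ ⋯ ≤ x*_{m+1}`: the eigenvalues of `J*_{m+1}`, with multiplicity, sorted
increasingly. -/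
noncomputable def starNode (μ : Measure ℝ) (m : ℕ) (k : Fin (m + 1)) : ℝ :=
  let hJ : (Jstar μ m).IsHermitian := tridiag_isHermitian _ _ _
  hJ.eigenvalues (Tuple.sort hJ.eigenvalues k)

/-- `v` is a normalized real eigenvector of `A` for the eigenvalue `t`. -/
def IsUnitEigenvector {n : ℕ} (A : Matrix (Fin n) (Fin n) ℝ) (t : ℝ) (v : Fin n → ℝ) : Prop :=
  A *ᵥ v = t • v ∧ v ⬝ᵥ v = 1

/-- The weight `β_0 v_1²` attached to a normalized eigenvector `v` of `J*_{m+1}`. -/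
noncomputable def starWeight (μ : Measure ℝ) {m : ℕ} (v : Fin (m + 1) → ℝ) : ℝ :=
  beta μ 0 * v 0 ^ 2

/-- The quadrature rule `f ↦ ∑ k, w k * f (x k)`. -/
def quadRule {n : ℕ} (x w : Fin n → ℝ) (f : ℝ → ℝ) : ℝ :=
  ∑ k, w k * f (x k)

/-- The quadrature rule `Q` has degree of exactness at least `d` for `μ`: it integrates every
polynomial of degree at most `d` exactly. -/
def HasExactness (μ : Measure ℝ) (Q : (ℝ → ℝ) → ℝ) (d : ℕ) : Prop :=
  ∀ f : ℝ[X], f.natDegree ≤ d → ∫ x, f.eval x ∂μ = Q fun x => f.eval x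

/-- The monic nodal polynomial `p*_{m+1}(x) = ∏ k, (x - x*_k)`. -/
noncomputable def starPoly (μ : Measure ℝ) (m : ℕ) : ℝ[X] :=
  ∏ k : Fin (m + 1), (X - C (starNode μ m k))

/-- `q_{2m+1} = p_m p*_{m+1}`. -/
noncomputable def qPoly (μ : Measure ℝ) (m : ℕ) : ℝ[X] :=
  orthoPoly μ m * starPoly μ m

theorem exists_isUnitEigenvector (μ : Measure ℝ) (m : ℕ) (k : Fin (m + 1)) :
    ∃ v, IsUnitEigenvector (Jstar μ m) (starNode μ m k) v := by
  have hJ : (Jstar μ m).IsHermitian := tridiag_isHermitian _ _ _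
  refine ⟨hJ.eigenvectorBasis (Tuple.sort hJ.eigenvalues k), hJ.mulVec_eigenvectorBasis _, ?_⟩
  have h := hJ.eigenvectorBasis.orthonormal.1 (Tuple.sort hJ.eigenvalues k)
  have h2 := EuclideanSpace.real_norm_sq_eq (hJ.eigenvectorBasis (Tuple.sort hJ.eigenvalues k))
  rw [h] at h2
  simp only [dotProduct, ← pow_two]
  linarith

section OrthoPoly

variable {μ : Measure ℝ}

theorem integrable_eval (hint : ∀ n : ℕ, Integrable (fun x : ℝ => x ^ n) μ) (f : ℝ[X]) :
    Integrable (fun x => f.eval x) μ := by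
  simp only [Polynomial.eval_eq_sum_range]
  exact integrable_finsetSum _ fun i _ => (hint i).const_mul _

theorem integrable_eval_mul (hint : ∀ n : ℕ, Integrable (fun x : ℝ => x ^ n) μ) (f g : ℝ[X]) :
    Integrable (fun x => f.eval x * g.eval x) μ := by
  simpa using integrable_eval hint (f * g)

theorem polyInner_sum_left (hint : ∀ n : ℕ, Integrable (fun x : ℝ => x ^ n) μ) {ι : Type*}
    (s : Finset ι) (c : ι → ℝ) (f : ι → ℝ[X]) (g : ℝ[X]) :
    polyInner μ (∑ i ∈ s, C (c i) * f i) g = ∑ i ∈ s, c i * polyInner μ (f i) g := by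
  simp only [polyInner, Polynomial.eval_finsetSum, Finset.sum_mul, ← integral_const_mul]
  rw [integral_finsetSum _ fun i _ => integrable_eval_mul hint _ _]
  simp [mul_assoc]

theorem polyInner_sub_left (hint : ∀ n : ℕ, Integrable (fun x : ℝ => x ^ n) μ) (f g h : ℝ[X]) :
    polyInner μ (f - g) h = polyInner μ f h - polyInner μ g h := by
  simp only [polyInner, Polynomial.eval_sub, sub_mul]
  exact integral_sub (integrable_eval_mul hint f h) (integrable_eval_mul hint g h)

theorem polyInner_comm (f g : ℝ[X]) : polyInner μ f g = polyInner μ g f := by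
  simp only [polyInner, mul_comm]

theorem polyInner_self_ne_zero (hint : ∀ n : ℕ, Integrable (fun x : ℝ => x ^ n) μ)
    (hsupp : μ.support.Infinite) {f : ℝ[X]} (hf : f ≠ 0) : polyInner μ f f ≠ 0 := by
  intro h
  rw [polyInner, integral_eq_zero_iff_of_nonneg (fun x => mul_self_nonneg _)
    (integrable_eval_mul hint f f)] at h
  have hfin : {x : ℝ | f.IsRoot x}.Finite := Polynomial.finite_setOfPred_isRoot hf
  refine hsupp (hfin.subset (Measure.support_subset_of_isClosed hfin.isClosed ?_))
  filter_upwards [h] with x hx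
  simpa using hx

theorem orthoPoly_eq (k : ℕ) : orthoPoly μ k = X ^ k - ∑ j : Fin k,
    C (polyInner μ (X ^ k) (orthoPoly μ j) / polyInner μ (orthoPoly μ j) (orthoPoly μ j)) *
      orthoPoly μ j := by
  rw [orthoPoly]

theorem degree_orthoPoly_sub_lt (k : ℕ) (ih : ∀ j < k, (orthoPoly μ j).natDegree = j) :
    (∑ j : Fin k,
      C (polyInner μ (X ^ k) (orthoPoly μ j) / polyInner μ (orthoPoly μ j) (orthoPoly μ j)) *
        orthoPoly μ j).degree < k := by
  refine (Polynomial.degree_sum_le _ _).trans_lt ((Finset.sup_lt_iff (WithBot.bot_lt_coe k)).2 ?_)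
  intro j _
  refine Polynomial.degree_le_natDegree.trans_lt ?_
  exact WithBot.coe_lt_coe.2
    ((Polynomial.natDegree_C_mul_le _ _).trans_lt ((ih j j.isLt).trans_lt j.isLt))

theorem orthoPoly_monic_natDegree (μ : Measure ℝ) (k : ℕ) :
    (orthoPoly μ k).Monic ∧ (orthoPoly μ k).natDegree = k := by
  induction k using Nat.strong_induction_on with
  | _ k ih =>
    have hlt := degree_orthoPoly_sub_lt (μ := μ) k fun j hj => (ih j hj).2
    have hm : (orthoPoly μ k).Monic := by
      rw [orthoPoly_eq]
      exact Polynomial.monic_X_pow_sub (n := k) hlt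
    refine ⟨hm, ?_⟩
    rw [orthoPoly_eq]
    refine Polynomial.natDegree_eq_of_degree_eq_some ?_
    rw [Polynomial.degree_sub_eq_left_of_degree_lt] <;> simp [hlt]

theorem polyInner_orthoPoly_of_lt (hint : ∀ n : ℕ, Integrable (fun x : ℝ => x ^ n) μ)
    (hsupp : μ.support.Infinite) {j k : ℕ} (hjk : j < k) :
    polyInner μ (orthoPoly μ k) (orthoPoly μ j) = 0 := by
  induction k using Nat.strong_induction_on generalizing j with
  | _ k ih =>
    rw [orthoPoly_eq k, polyInner_sub_left hint, polyInner_sum_left hint,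
      Finset.sum_eq_single (⟨j, hjk⟩ : Fin k)]
    · have := polyInner_self_ne_zero hint hsupp (orthoPoly_monic_natDegree μ j).1.ne_zero
      simp only
      rw [div_mul_cancel₀ _ this, sub_self]
    · intro i _ hi
      have hne : (i : ℕ) ≠ j := fun h => hi (Fin.ext h)
      rcases lt_or_gt_of_ne hne with h | h
      · rw [polyInner_comm (orthoPoly μ i) (orthoPoly μ j), ih j hjk h, mul_zero]
      · rw [ih i i.isLt h, mul_zero]
    · intro h; exact absurd (Finset.mem_univ _) h

/-- A polynomial orthogonal to `1, x, …, x^(k-1)` is orthogonal to all polynomials of degree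
less than `k`. -/
theorem polyInner_eq_zero_of_degree_lt (hint : ∀ n : ℕ, Integrable (fun x : ℝ => x ^ n) μ)
    {k : ℕ} {p : ℝ[X]} (hp : ∀ j < k, polyInner μ (X ^ j) p = 0) {f : ℝ[X]} (hf : f.degree < k) :
    polyInner μ f p = 0 := by
  by_cases h0 : f = 0
  · simp [h0, polyInner]
  rw [f.as_sum_range_C_mul_X_pow' ((Polynomial.natDegree_lt_iff_degree_lt h0).2 hf),
    polyInner_sum_left hint]
  exact Finset.sum_eq_zero fun j hj => by rw [hp j (Finset.mem_range.1 hj), mul_zero]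

theorem polyInner_X_pow_orthoPoly (hint : ∀ n : ℕ, Integrable (fun x : ℝ => x ^ n) μ)
    (hsupp : μ.support.Infinite) {j k : ℕ} (hjk : j < k) :
    polyInner μ (X ^ j) (orthoPoly μ k) = 0 := by
  induction j using Nat.strong_induction_on with
  | _ j ih =>
    have h := polyInner_orthoPoly_of_lt hint hsupp hjk
    rw [polyInner_comm, orthoPoly_eq j, polyInner_sub_left hint, polyInner_sum_left hint,
      Finset.sum_eq_zero, sub_zero] at h
    · exact h
    · intro i _
      rw [polyInner_comm (orthoPoly μ i) (orthoPoly μ k),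
        polyInner_orthoPoly_of_lt hint hsupp (i.isLt.trans hjk), mul_zero]

/-- `orthoPoly μ k` is the unique monic polynomial of degree `k` with `⟨x^j, p⟩_μ = 0` for
`j < k`. -/
theorem eq_orthoPoly_iff (hint : ∀ n : ℕ, Integrable (fun x : ℝ => x ^ n) μ)
    (hsupp : μ.support.Infinite) (k : ℕ) (p : ℝ[X]) :
    (p.Monic ∧ p.natDegree = k ∧ ∀ j < k, polyInner μ (X ^ j) p = 0) ↔ p = orthoPoly μ k := by
  obtain ⟨hm, hd⟩ := orthoPoly_monic_natDegree μ k
  constructor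
  · rintro ⟨hpm, hpd, hpo⟩
    by_contra hne
    have h0 : p - orthoPoly μ k ≠ 0 := sub_ne_zero.2 hne
    have hlt : (p - orthoPoly μ k).degree < k := by
      have hdeg : p.degree = k := by rw [Polynomial.degree_eq_natDegree hpm.ne_zero, hpd]
      have hdeg' : (orthoPoly μ k).degree = k := by
        rw [Polynomial.degree_eq_natDegree hm.ne_zero, hd]
      rw [← hdeg]
      exact Polynomial.degree_sub_lt_left (hdeg.trans hdeg'.symm) hpm.ne_zero
        (hpm.leadingCoeff.trans hm.leadingCoeff.symm)
    apply polyInner_self_ne_zero hint hsupp h0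
    rw [polyInner_sub_left hint, polyInner_comm, polyInner_comm (orthoPoly μ k),
      polyInner_eq_zero_of_degree_lt hint hpo hlt,
      polyInner_eq_zero_of_degree_lt hint
        (fun j hj => polyInner_X_pow_orthoPoly hint hsupp hj) hlt, sub_zero]
  · rintro rfl
    exact ⟨hm, hd, fun j hj => polyInner_X_pow_orthoPoly hint hsupp hj⟩

end OrthoPoly

end AveragedGauss

/-! Let `r_k` be the monic polynomials of the recurrence with coefficients `α_k`, `β_k`, except that
`β_m` is replaced by `β_m + β_{m+1}`. This change first enters in `r_{m+1}`, so `r_k = p_k` for `k ≤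
m`. The rows of `J* v = t v` are the recurrence in disguise: `v_i ∏ b_j = v_0 r_i(t)`, and the last
row says `r_{m+1}(t) = 0` (`tridiag_eigenvector_extendZero`). Hence eigenspaces are lines, the nodes
are distinct, and `p* = r_{m+1}`.

Weights: inserting this formula into `v ⬝ᵥ v = 1` and summing by the confluent Christoffel–Darboux
formula gives `v_0² r'_{m+1}(t) r_m(t) = ∏ b_j²`. Since `p*` vanishes at the nodes, this is claim 3
(`starWeight_mul_derivative_qPoly`).

Interlacing: `λ*_k > 0` forces `q'(x*_k) = p*'(x*_k) p_m(x*_k) > 0`. As `p*'` alternates in sign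
along the nodes, so does `p_m`, which thus has a zero in each of the `m` gaps.

Exactness: coordinates of an orthonormal eigenbasis are dually orthonormal, so the rule reproduces
`⟨p_i, p_j⟩` for distinct `i, j ≤ m` and for `i = j = 0`. Division by `p_m` reduces degree `2m - 1`
to these products. -/

namespace AveragedGauss

/-! ### Monic three-term recurrences and Christoffel–Darboux -/

/-- The monic polynomials defined by the three-term recurrence
`r (k + 1) = (X - a k) * r k - c k * r (k - 1)`. -/
noncomputable def jacobiPoly (a c : ℕ → ℝ) : ℕ → ℝ[X]
  | 0 => 1
  | 1 => X - C (a 0)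
  | k + 2 => (X - C (a (k + 1))) * jacobiPoly a c (k + 1) - C (c (k + 1)) * jacobiPoly a c k

section Jacobi

variable (a c : ℕ → ℝ)

theorem jacobiPoly_add_two (k : ℕ) : jacobiPoly a c (k + 2) =
    (X - C (a (k + 1))) * jacobiPoly a c (k + 1) - C (c (k + 1)) * jacobiPoly a c k := by
  rw [jacobiPoly]

/-- Up to index `n` only `c 1, …, c (n - 1)` enter the recurrence. -/
theorem jacobiPoly_congr {c c' : ℕ → ℝ} {n : ℕ} (h : ∀ k < n, c k = c' k) {k : ℕ} (hk : k ≤ n) :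
    jacobiPoly a c k = jacobiPoly a c' k := by
  induction k using Nat.strong_induction_on with
  | _ k ih =>
    match k with
    | 0 => simp [jacobiPoly]
    | 1 => simp [jacobiPoly]
    | k + 2 =>
      rw [jacobiPoly_add_two, jacobiPoly_add_two, ih (k + 1) (by omega) (by omega),
        ih k (by omega) (by omega), h (k + 1) (by omega)]

theorem monic_sub_of_natDegree_lt {k : ℕ} {p q : ℝ[X]} (hp : p.Monic) (hpd : p.natDegree = k + 1)
    (hqd : q.natDegree = k) (s t : ℝ) :
    ((X - C s) * p - C t * q).Monic ∧ ((X - C s) * p - C t * q).natDegree = k + 2 := by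
  have hd : ((X - C s) * p).natDegree = k + 2 := by
    rw [(monic_X_sub_C s).natDegree_mul hp, natDegree_X_sub_C, hpd]; omega
  have hlt : (C t * q).natDegree < ((X - C s) * p).natDegree := by
    have := natDegree_C_mul_le t q
    omega
  refine ⟨((monic_X_sub_C s).mul hp).sub_of_left (degree_lt_degree hlt), ?_⟩
  rw [natDegree_sub_eq_left_of_natDegree_lt hlt, hd]

theorem jacobiPoly_monic_natDegree (k : ℕ) :
    (jacobiPoly a c k).Monic ∧ (jacobiPoly a c k).natDegree = k := by
  induction k using Nat.strong_induction_on with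
  | _ k ih =>
    match k with
    | 0 => simp [jacobiPoly]
    | 1 => exact ⟨monic_X_sub_C _, natDegree_X_sub_C _⟩
    | k + 2 =>
      rw [jacobiPoly_add_two]
      exact monic_sub_of_natDegree_lt (ih _ (by omega)).1 (ih _ (by omega)).2
        (ih _ (by omega)).2 _ _

/-- The confluent Christoffel–Darboux formula. -/
theorem jacobiPoly_christoffelDarboux (t : ℝ) (n : ℕ) (hc : ∀ k < n, c (k + 1) ≠ 0) :
    (∏ j ∈ Finset.range n, c (j + 1)) * ∑ i ∈ Finset.range (n + 1),
      (jacobiPoly a c i).eval t ^ 2 / ∏ j ∈ Finset.range i, c (j + 1) =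
    (jacobiPoly a c (n + 1)).derivative.eval t * (jacobiPoly a c n).eval t -
      (jacobiPoly a c (n + 1)).eval t * (jacobiPoly a c n).derivative.eval t := by
  induction n with
  | zero => simp [jacobiPoly]
  | succ n ih =>
    have ih' := ih fun k hk => hc k (by omega)
    have hp : ∏ j ∈ Finset.range (n + 1), c (j + 1) ≠ 0 :=
      Finset.prod_ne_zero_iff.2 fun j hj => hc j (Finset.mem_range.1 hj)
    -- With `W_n` the right-hand side, the recurrence and its derivative give `W_{n+1} = r_{n+1}² +
    -- c_{n+1} W_n`.
    rw [Finset.sum_range_succ, mul_add, mul_div_cancel₀ _ hp, Finset.prod_range_succ,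
      mul_right_comm, ih', jacobiPoly_add_two]
    simp
    ring

end Jacobi

/-! ### Eigenvectors of tridiagonal matrices -/

section Tridiagonal

variable {n : ℕ} {a b : ℕ → ℝ} {v : Fin (n + 1) → ℝ} {t : ℝ}

/-- Extension by zero of a vector to a sequence. -/
def extendZero {n : ℕ} (v : Fin n → ℝ) (i : ℕ) : ℝ := if h : i < n then v ⟨i, h⟩ else 0

theorem extendZero_coe {n : ℕ} (v : Fin n → ℝ) (i : Fin n) : extendZero v i = v i := by
  simp [extendZero]

theorem tridiag_mulVec (i : Fin (n + 1)) :
    (tridiag (n + 1) a b *ᵥ v) i = a i * extendZero v i + b (i + 1) * extendZero v (i + 1) +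
      (if (i : ℕ) = 0 then 0 else b i * extendZero v (i - 1)) := by
  -- Each row is a sum of three delta functions. For `i = 0` the truncated `i - 1` equals `i`, so
  -- the third term must be switched off explicitly.
  have h1 : (tridiag (n + 1) a b *ᵥ v) i = ∑ j ∈ Finset.range (n + 1),
      ((if j = (i : ℕ) then a i * extendZero v i else 0) +
        (if j = (i : ℕ) + 1 then b (i + 1) * extendZero v (i + 1) else 0) +
        (if j = (i : ℕ) - 1 then (if (i : ℕ) = 0 then 0 else b i * extendZero v (i - 1)) else 0)) := by
    rw [← Fin.sum_univ_eq_sum_range (fun j => ((if j = (i : ℕ) then a i * extendZero v i else 0) +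
        (if j = (i : ℕ) + 1 then b (i + 1) * extendZero v (i + 1) else 0) +
        (if j = (i : ℕ) - 1 then (if (i : ℕ) = 0 then 0 else b i * extendZero v (i - 1)) else 0)))]
    simp only [mulVec, dotProduct]
    refine Finset.sum_congr rfl fun j _ => ?_
    rw [← extendZero_coe v j]
    simp only [tridiag, Matrix.of_apply, Fin.ext_iff]
    rcases lt_trichotomy (i : ℕ) j with h | h | h
    · by_cases h' : (i : ℕ) + 1 = j
      · rw [← h']
        simp [show ¬ (i : ℕ) + 1 = i - 1 by omega]
      · simp [h.ne, h', h.ne', show ¬ (j : ℕ) + 1 = i by omega, show ¬ (j : ℕ) = i + 1 by omega,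
          show ¬ (j : ℕ) = i - 1 by omega]
    · by_cases h0 : (i : ℕ) = 0
      · simp [← h, h0]
      · simp [← h, show ¬ (i : ℕ) = i - 1 by omega]
    · by_cases h' : (j : ℕ) + 1 = i
      · rw [← h']
        simp [show ¬ (j : ℕ) = j + 1 + 1 by omega, show ¬ (j : ℕ) + 1 + 1 = j by omega]
      · simp [h.ne, h', h.ne', show ¬ (i : ℕ) + 1 = j by omega, show ¬ (j : ℕ) = i + 1 by omega,
          show ¬ (j : ℕ) = i - 1 by omega]
  rw [h1, Finset.sum_add_distrib, Finset.sum_add_distrib, Finset.sum_ite_eq', Finset.sum_ite_eq',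
    Finset.sum_ite_eq', if_pos (Finset.mem_range.2 i.2),
    if_pos (Finset.mem_range.2 (by omega : (i : ℕ) - 1 < n + 1))]
  congr 2
  by_cases h : (i : ℕ) + 1 < n + 1
  · rw [if_pos (Finset.mem_range.2 h)]
  · rw [if_neg (by simpa using h), extendZero, dif_neg h, mul_zero]

/-- Each row of the eigenvector equation, multiplied by the product of the earlier off-diagonal
entries, is one step of the recurrence. The index `n + 1` is allowed on purpose: there the extension
vanishes, so the last row becomes the characteristic equation. -/
theorem tridiag_eigenvector_extendZero (hv : tridiag (n + 1) a b *ᵥ v = t • v) {i : ℕ}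
    (hi : i ≤ n + 1) :
    extendZero v i * ∏ j ∈ Finset.range i, b (j + 1) =
      v 0 * (jacobiPoly a (fun k => b k ^ 2) i).eval t := by
  have row : ∀ k (hk : k < n + 1), a k * extendZero v k + b (k + 1) * extendZero v (k + 1) +
      (if k = 0 then 0 else b k * extendZero v (k - 1)) = t * extendZero v k := by
    intro k hk
    have := congrFun hv ⟨k, hk⟩
    rw [tridiag_mulVec] at this
    simp only [Pi.smul_apply, smul_eq_mul] at this
    rwa [← extendZero_coe v ⟨k, hk⟩] at this
  have h0 : extendZero v 0 = v 0 := extendZero_coe v 0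
  induction i using Nat.strong_induction_on with
  | _ i ih =>
    match i with
    | 0 => simp [jacobiPoly, h0]
    | 1 =>
      have := row 0 (by omega)
      simp [h0] at this
      simp [jacobiPoly]
      linarith
    | k + 2 =>
      have e1 := ih (k + 1) (by omega) (by omega)
      have e0 := ih k (by omega) (by omega)
      have := row (k + 1) (by omega)
      simp at this
      rw [jacobiPoly_add_two]
      simp only [eval_sub, eval_mul, eval_X, eval_C]
      have e : v 0 * ((t - a (k + 1)) * (jacobiPoly a (fun k => b k ^ 2) (k + 1)).eval t -
          b (k + 1) ^ 2 * (jacobiPoly a (fun k => b k ^ 2) k).eval t) =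
          (t - a (k + 1)) * (v 0 * (jacobiPoly a (fun k => b k ^ 2) (k + 1)).eval t) -
          b (k + 1) ^ 2 * (v 0 * (jacobiPoly a (fun k => b k ^ 2) k).eval t) := by ring
      rw [e, ← e1, ← e0, Finset.prod_range_succ, Finset.prod_range_succ]
      linear_combination (∏ j ∈ Finset.range k, b (j + 1)) * b (k + 1) * this

theorem tridiag_eigenvector_apply (hv : tridiag (n + 1) a b *ᵥ v = t • v) (i : Fin (n + 1)) :
    v i * ∏ j ∈ Finset.range i, b (j + 1) =
      v 0 * (jacobiPoly a (fun k => b k ^ 2) i).eval t := by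
  rw [← tridiag_eigenvector_extendZero hv i.2.le, extendZero_coe]

theorem prod_offDiag_ne_zero (hb : ∀ k < n, b (k + 1) ≠ 0) {i : ℕ} (hi : i ≤ n) :
    ∏ j ∈ Finset.range i, b (j + 1) ≠ 0 :=
  Finset.prod_ne_zero_iff.2 fun j hj => hb j ((Finset.mem_range.1 hj).trans_le hi)

theorem tridiag_eigenvector_zero_ne_zero (hb : ∀ k < n, b (k + 1) ≠ 0)
    (hv : tridiag (n + 1) a b *ᵥ v = t • v) (h : v ≠ 0) : v 0 ≠ 0 := by
  intro h0
  refine h (funext fun i => ?_)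
  have := tridiag_eigenvector_apply hv i
  rw [h0, zero_mul] at this
  exact (mul_eq_zero.1 this).resolve_right (prod_offDiag_ne_zero hb (Nat.lt_succ_iff.1 i.2))

theorem jacobiPoly_eval_eigenvalue (hb : ∀ k < n, b (k + 1) ≠ 0)
    (hv : tridiag (n + 1) a b *ᵥ v = t • v) (h : v ≠ 0) :
    (jacobiPoly a (fun k => b k ^ 2) (n + 1)).eval t = 0 := by
  have := tridiag_eigenvector_extendZero hv le_rfl
  rw [extendZero, dif_neg (lt_irrefl _), zero_mul] at this
  exact (mul_eq_zero.1 this.symm).resolve_left (tridiag_eigenvector_zero_ne_zero hb hv h)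

/-- The eigenspaces of a tridiagonal matrix with nonzero off-diagonal are one-dimensional. -/
theorem tridiag_eigenvector_proportional (hb : ∀ k < n, b (k + 1) ≠ 0) {w : Fin (n + 1) → ℝ}
    (hv : tridiag (n + 1) a b *ᵥ v = t • v) (hw : tridiag (n + 1) a b *ᵥ w = t • w) :
    w 0 • v = v 0 • w := by
  funext i
  have h1 := tridiag_eigenvector_apply hv i
  have h2 := tridiag_eigenvector_apply hw i
  have h3 := prod_offDiag_ne_zero hb (Nat.lt_succ_iff.1 i.2)
  simp only [Pi.smul_apply, smul_eq_mul]
  apply mul_right_cancel₀ h3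
  linear_combination w 0 * h1 - v 0 * h2

theorem tridiag_eigenvalues_injective (hb : ∀ k < n, b (k + 1) ≠ 0)
    (hA : (tridiag (n + 1) a b).IsHermitian) : Function.Injective hA.eigenvalues := by
  intro i j hij
  by_contra hne
  have hi := hA.mulVec_eigenvectorBasis i
  have hj := hA.mulVec_eigenvectorBasis j
  rw [← hij] at hj
  have hp := tridiag_eigenvector_proportional hb hi hj
  have ho : (hA.eigenvectorBasis i).ofLp ⬝ᵥ (hA.eigenvectorBasis j).ofLp = 0 := by
    have := hA.eigenvectorBasis.orthonormal.inner_eq_zero hne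
    rw [EuclideanSpace.inner_eq_star_dotProduct] at this
    simpa [dotProduct_comm] using this
  have hne0 : ∀ k, (hA.eigenvectorBasis k).ofLp ≠ 0 := fun k h =>
    hA.eigenvectorBasis.orthonormal.ne_zero k (by ext x; exact congrFun h x)
  have h0 := tridiag_eigenvector_zero_ne_zero hb hi (hne0 i)
  -- Two orthogonal eigenvectors of one eigenvalue are proportional; pairing the relation with the
  -- second gives `0 = v_0 (w ⬝ᵥ w)`.
  have hd := congrArg (fun u => u ⬝ᵥ (hA.eigenvectorBasis j).ofLp) hp
  simp only [smul_dotProduct, ho, smul_zero] at hd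
  exact hne0 j (dotProduct_self_eq_zero.1 ((smul_eq_zero.1 hd.symm).resolve_left h0))

theorem eigenvector_dotProduct_eq_zero {A : Matrix (Fin n) (Fin n) ℝ} (hA : A.IsHermitian)
    {s t : ℝ} (hst : s ≠ t) {v w : Fin n → ℝ} (hv : A *ᵥ v = s • v) (hw : A *ᵥ w = t • w) :
    v ⬝ᵥ w = 0 := by
  have hT : Aᵀ = A := by rwa [← conjTranspose_eq_transpose_of_trivial]
  have h1 : (A *ᵥ v) ⬝ᵥ w = v ⬝ᵥ (A *ᵥ w) := by
    rw [dotProduct_mulVec, ← mulVec_transpose, hT]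
  rw [hv, hw, smul_dotProduct, dotProduct_smul, smul_eq_mul, smul_eq_mul, ← sub_eq_zero,
    ← sub_mul] at h1
  exact (mul_eq_zero.1 h1).resolve_left (sub_ne_zero.2 hst)

/-- Dual orthogonality: the coordinates of an orthonormal eigenvector system are orthonormal. -/
theorem sum_eigenvector_mul {A : Matrix (Fin n) (Fin n) ℝ} (hA : A.IsHermitian)
    {x : Fin n → ℝ} (hx : Function.Injective x) {v : Fin n → Fin n → ℝ}
    (hv : ∀ k, IsUnitEigenvector A (x k) (v k)) (i j : Fin n) :
    ∑ k, v k i * v k j = if i = j then 1 else 0 := by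
  have h : Matrix.of v * (Matrix.of v)ᵀ = 1 := by
    ext k l
    rw [Matrix.mul_apply, Matrix.one_apply]
    split_ifs with hkl
    · subst hkl
      exact (hv k).2
    · exact eigenvector_dotProduct_eq_zero hA (hx.ne hkl) (hv k).1 (hv l).1
  have h' : ((Matrix.of v)ᵀ * Matrix.of v) i j = (1 : Matrix (Fin n) (Fin n) ℝ) i j := by
    rw [mul_eq_one_comm.1 h]
  rwa [Matrix.mul_apply, Matrix.one_apply] at h'

theorem IsUnitEigenvector.ne_zero {A : Matrix (Fin n) (Fin n) ℝ} {v : Fin n → ℝ}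
    (hv : IsUnitEigenvector A t v) : v ≠ 0 := by
  rintro rfl
  simpa using hv.2

/-- The first component of a normalized eigenvector in terms of the characteristic
polynomial and its predecessor. -/
theorem IsUnitEigenvector.zero_sq_mul (hb : ∀ k < n, b (k + 1) ≠ 0)
    (hv : IsUnitEigenvector (tridiag (n + 1) a b) t v) :
    v 0 ^ 2 * ((jacobiPoly a (fun k => b k ^ 2) (n + 1)).derivative.eval t *
      (jacobiPoly a (fun k => b k ^ 2) n).eval t) = ∏ j ∈ Finset.range n, b (j + 1) ^ 2 := by
  have hcd := jacobiPoly_christoffelDarboux a (fun k => b k ^ 2) t n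
    fun k hk => pow_ne_zero 2 (hb k hk)
  rw [jacobiPoly_eval_eigenvalue hb hv.1 hv.ne_zero, zero_mul, sub_zero] at hcd
  -- The normalization `v ⬝ᵥ v = 1`, with each `v i` expressed through `v 0`, is `v_0²` times the
  -- Christoffel–Darboux sum.
  have h1 : v 0 ^ 2 * ∑ i ∈ Finset.range (n + 1),
      (jacobiPoly a (fun k => b k ^ 2) i).eval t ^ 2 / ∏ j ∈ Finset.range i, b (j + 1) ^ 2 = 1 := by
    rw [← hv.2, dotProduct, Finset.mul_sum, ← Fin.sum_univ_eq_sum_range (fun i => v 0 ^ 2 *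
      ((jacobiPoly a (fun k => b k ^ 2) i).eval t ^ 2 / ∏ j ∈ Finset.range i, b (j + 1) ^ 2))]
    refine Finset.sum_congr rfl fun i _ => ?_
    have h2 := tridiag_eigenvector_apply hv.1 i
    have h3 := prod_offDiag_ne_zero hb (Nat.lt_succ_iff.1 i.2)
    rw [Finset.prod_pow, ← mul_div_assoc, div_eq_iff (pow_ne_zero 2 h3), ← mul_pow, ← h2]
    ring
  rw [← hcd, mul_left_comm, h1, mul_one]

end Tridiagonal

/-! ### The three-term recurrence of the orthogonal polynomials -/

section Recurrence

variable {μ : Measure ℝ}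

theorem orthoPoly_zero (μ : Measure ℝ) : orthoPoly μ 0 = 1 := by
  rw [orthoPoly_eq]
  simp

theorem X_pow_eq_orthoPoly_add (μ : Measure ℝ) (k : ℕ) : (X : ℝ[X]) ^ k = orthoPoly μ k +
    ∑ j : Fin k, (polyInner μ (X ^ k) (orthoPoly μ j) /
      polyInner μ (orthoPoly μ j) (orthoPoly μ j)) • orthoPoly μ j := by
  simp only [smul_eq_C_mul]
  conv_rhs => rw [orthoPoly_eq k]
  rw [sub_add_cancel]

/-- A linear map vanishing at `p_0, …, p_(n-1)` vanishes at all polynomials of degree less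
than `n`. -/
theorem linearMap_eq_zero_of_degree_lt {n : ℕ} (L : ℝ[X] →ₗ[ℝ] ℝ)
    (hL : ∀ j < n, L (orthoPoly μ j) = 0) {f : ℝ[X]} (hf : f.degree < n) : L f = 0 := by
  have hX : ∀ j < n, L (X ^ j) = 0 := by
    intro j hj
    rw [X_pow_eq_orthoPoly_add μ j, map_add, hL j hj, map_sum, Finset.sum_eq_zero, add_zero]
    intro i _
    rw [map_smul, hL i (i.2.trans hj), smul_zero]
  by_cases h0 : f = 0
  · rw [h0, map_zero]
  rw [f.as_sum_range_C_mul_X_pow' ((natDegree_lt_iff_degree_lt h0).2 hf), map_sum]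
  refine Finset.sum_eq_zero fun j hj => ?_
  rw [← smul_eq_C_mul, map_smul, hX j (Finset.mem_range.1 hj), smul_zero]

/-- Integration of polynomials as a linear map. -/
noncomputable def integralMap (hint : ∀ n : ℕ, Integrable (fun x : ℝ => x ^ n) μ) :
    ℝ[X] →ₗ[ℝ] ℝ where
  toFun f := ∫ x, f.eval x ∂μ
  map_add' f g := by
    simp only [eval_add]
    exact integral_add (integrable_eval hint f) (integrable_eval hint g)
  map_smul' c f := by
    simp only [eval_smul, smul_eq_mul, integral_const_mul, RingHom.id_apply]

theorem integralMap_mul (hint : ∀ n : ℕ, Integrable (fun x : ℝ => x ^ n) μ) (f g : ℝ[X]) :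
    integralMap hint (f * g) = polyInner μ f g := by
  simp [integralMap, polyInner]

variable (hint : ∀ n : ℕ, Integrable (fun x : ℝ => x ^ n) μ) (hsupp : μ.support.Infinite)
include hint hsupp

theorem polyInner_self_pos {f : ℝ[X]} (hf : f ≠ 0) : 0 < polyInner μ f f :=
  lt_of_le_of_ne (integral_nonneg fun _ => mul_self_nonneg _)
    (polyInner_self_ne_zero hint hsupp hf).symm

theorem polyInner_orthoPoly_pos (k : ℕ) : 0 < polyInner μ (orthoPoly μ k) (orthoPoly μ k) :=
  polyInner_self_pos hint hsupp (orthoPoly_monic_natDegree μ k).1.ne_zero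

theorem beta_pos (k : ℕ) : 0 < beta μ k := by
  cases k with
  | zero => exact polyInner_orthoPoly_pos hint hsupp 0
  | succ k =>
    exact div_pos (polyInner_orthoPoly_pos hint hsupp _) (polyInner_orthoPoly_pos hint hsupp _)

theorem prod_beta (k : ℕ) : beta μ 0 * ∏ j ∈ Finset.range k, beta μ (j + 1) =
    polyInner μ (orthoPoly μ k) (orthoPoly μ k) := by
  induction k with
  | zero => simp [beta]
  | succ k ih =>
    rw [Finset.prod_range_succ, ← mul_assoc, ih, beta,
      mul_div_cancel₀ _ (polyInner_orthoPoly_pos hint hsupp k).ne']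

theorem polyInner_orthoPoly_of_degree_lt {k : ℕ} {f : ℝ[X]} (hf : f.degree < k) :
    polyInner μ f (orthoPoly μ k) = 0 :=
  polyInner_eq_zero_of_degree_lt hint (fun _ hj => polyInner_X_pow_orthoPoly hint hsupp hj) hf

theorem polyInner_orthoPoly_of_ne {j k : ℕ} (h : j ≠ k) :
    polyInner μ (orthoPoly μ j) (orthoPoly μ k) = 0 := by
  rcases lt_or_gt_of_ne h with h | h
  · rw [polyInner_comm, polyInner_orthoPoly_of_lt hint hsupp h]
  · exact polyInner_orthoPoly_of_lt hint hsupp h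

/-- The `p_j` with `j < k` span the same space as the monomials of degree below `k`, so
orthogonality may be tested on them. -/
theorem eq_orthoPoly_of_polyInner_orthoPoly {k : ℕ} {p : ℝ[X]} (hp : p.Monic)
    (hd : p.natDegree = k) (ho : ∀ j < k, polyInner μ p (orthoPoly μ j) = 0) :
    p = orthoPoly μ k := by
  refine (eq_orthoPoly_iff hint hsupp k p).1 ⟨hp, hd, fun j hj => ?_⟩
  rw [polyInner_comm, ← integralMap_mul hint]
  refine linearMap_eq_zero_of_degree_lt (μ := μ) (n := k)
    ((integralMap hint).comp (LinearMap.mulLeft ℝ p)) (fun j hj => ?_) ?_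
  · simpa [integralMap_mul] using ho j hj
  · rw [degree_X_pow]
    exact_mod_cast hj

/-- The leading terms of `x p_k` and `p_{k+1}` cancel, so their difference is orthogonal to
`p_{k+1}`. -/
theorem polyInner_X_mul_orthoPoly_succ (k : ℕ) :
    polyInner μ (X * orthoPoly μ k) (orthoPoly μ (k + 1)) =
      polyInner μ (orthoPoly μ (k + 1)) (orthoPoly μ (k + 1)) := by
  obtain ⟨hm, hd⟩ := orthoPoly_monic_natDegree μ k
  obtain ⟨hm', hd'⟩ := orthoPoly_monic_natDegree μ (k + 1)
  rw [← sub_eq_zero, ← polyInner_sub_left hint]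
  refine polyInner_orthoPoly_of_degree_lt hint hsupp ?_
  have e : (X * orthoPoly μ k : ℝ[X]).degree = (k + 1 : ℕ) := by
    rw [degree_eq_natDegree (monic_X.mul hm).ne_zero, monic_X.natDegree_mul hm, hd, natDegree_X,
      add_comm]
  have e' : (orthoPoly μ (k + 1)).degree = (k + 1 : ℕ) := by
    rw [degree_eq_natDegree hm'.ne_zero, hd']
  exact e ▸ degree_sub_lt_left (e.trans e'.symm) (monic_X.mul hm).ne_zero
    ((monic_X.mul hm).leadingCoeff.trans hm'.leadingCoeff.symm)

omit hsupp in
theorem polyInner_recurrence (s t : ℝ) (p q f : ℝ[X]) :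
    polyInner μ ((X - C s) * p - C t * q) f =
      polyInner μ (X * p) f - s * polyInner μ p f - t * polyInner μ q f := by
  have e : ((X - C s) * p - C t * q) * f = X * p * f - s • (p * f) - t • (q * f) := by
    simp only [smul_eq_C_mul]
    ring
  rw [← integralMap_mul hint, e, map_sub, map_sub, map_smul, map_smul]
  simp only [integralMap_mul, smul_eq_mul]

theorem alpha_mul_polyInner (k : ℕ) : alpha μ k * polyInner μ (orthoPoly μ k) (orthoPoly μ k) =
    polyInner μ (X * orthoPoly μ k) (orthoPoly μ k) :=
  div_mul_cancel₀ _ (polyInner_orthoPoly_pos hint hsupp k).ne'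

theorem beta_mul_polyInner (k : ℕ) :
    beta μ (k + 1) * polyInner μ (orthoPoly μ k) (orthoPoly μ k) =
      polyInner μ (orthoPoly μ (k + 1)) (orthoPoly μ (k + 1)) :=
  div_mul_cancel₀ _ (polyInner_orthoPoly_pos hint hsupp k).ne'

theorem orthoPoly_add_two (k : ℕ) : orthoPoly μ (k + 2) =
    (X - C (alpha μ (k + 1))) * orthoPoly μ (k + 1) - C (beta μ (k + 1)) * orthoPoly μ k := by
  obtain ⟨hm, hd⟩ := monic_sub_of_natDegree_lt (orthoPoly_monic_natDegree μ (k + 1)).1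
    (orthoPoly_monic_natDegree μ (k + 1)).2 (orthoPoly_monic_natDegree μ k).2
    (alpha μ (k + 1)) (beta μ (k + 1))
  refine (eq_orthoPoly_of_polyInner_orthoPoly hint hsupp hm hd fun j hj => ?_).symm
  rw [polyInner_recurrence hint]
  have hX : polyInner μ (X * orthoPoly μ (k + 1)) (orthoPoly μ j) =
      polyInner μ (X * orthoPoly μ j) (orthoPoly μ (k + 1)) := by
    simp only [polyInner, eval_mul, eval_X]
    congr 1
    funext x
    ring
  -- The choice of `α` settles `j = k + 1` and that of `β` settles `j = k`; for `j < k` the degree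
  -- of `x p_j` is below `k + 1`.
  rcases (by omega : j = k + 1 ∨ j = k ∨ j < k) with rfl | rfl | h
  · rw [alpha_mul_polyInner hint hsupp, polyInner_orthoPoly_of_ne hint hsupp (by omega : k ≠ k + 1)]
    ring
  · rw [hX, beta_mul_polyInner hint hsupp, polyInner_X_mul_orthoPoly_succ hint hsupp,
      polyInner_orthoPoly_of_ne hint hsupp (by omega : j + 1 ≠ j)]
    ring
  · rw [hX, polyInner_orthoPoly_of_ne hint hsupp (by omega : k + 1 ≠ j),
      polyInner_orthoPoly_of_ne hint hsupp h.ne', polyInner_orthoPoly_of_degree_lt hint hsupp]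
    · ring
    · obtain ⟨hm, hd⟩ := orthoPoly_monic_natDegree μ j
      rw [degree_eq_natDegree (monic_X.mul hm).ne_zero, monic_X.natDegree_mul hm, hd, natDegree_X]
      exact_mod_cast (by omega : 1 + j < k + 1)

theorem orthoPoly_eq_jacobiPoly (k : ℕ) : orthoPoly μ k = jacobiPoly (alpha μ) (beta μ) k := by
  induction k using Nat.strong_induction_on with
  | _ k ih =>
    match k with
    | 0 => simp [jacobiPoly, orthoPoly_zero]
    | 1 =>
      refine (eq_orthoPoly_of_polyInner_orthoPoly hint hsupp (monic_X_sub_C _)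
        (natDegree_X_sub_C _) fun j hj => ?_).symm
      obtain rfl : j = 0 := by omega
      have h := polyInner_recurrence hint (alpha μ 0) 0 (orthoPoly μ 0) 0 (orthoPoly μ 0)
      rw [alpha_mul_polyInner hint hsupp] at h
      simpa [orthoPoly_zero] using h
    | k + 2 =>
      rw [orthoPoly_add_two hint hsupp, jacobiPoly_add_two, ih _ (by omega), ih _ (by omega)]

end Recurrence

/-! ### The matrix `J*`, its nodes and weights -/

section Star

/-- The off-diagonal entries of `J*_{m+1}`. -/
noncomputable def starOffDiag (μ : Measure ℝ) (m k : ℕ) : ℝ :=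
  if k = m then Real.sqrt (beta μ m + beta μ (m + 1)) else Real.sqrt (beta μ k)

variable {μ : Measure ℝ} (hint : ∀ n : ℕ, Integrable (fun x : ℝ => x ^ n) μ)
  (hsupp : μ.support.Infinite) (m : ℕ)
include hint hsupp

theorem starOffDiag_ne_zero (k : ℕ) : starOffDiag μ m k ≠ 0 := by
  have := beta_pos hint hsupp
  unfold starOffDiag
  split_ifs
  · exact (Real.sqrt_pos.2 (add_pos (this _) (this _))).ne'
  · exact (Real.sqrt_pos.2 (this _)).ne'

theorem starOffDiag_sq_self : starOffDiag μ m m ^ 2 = beta μ m + beta μ (m + 1) := by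
  have := beta_pos hint hsupp
  rw [starOffDiag, if_pos rfl, Real.sq_sqrt (add_pos (this _) (this _)).le]

theorem starOffDiag_sq_of_ne {k : ℕ} (h : k ≠ m) : starOffDiag μ m k ^ 2 = beta μ k := by
  rw [starOffDiag, if_neg h, Real.sq_sqrt (beta_pos hint hsupp _).le]

theorem jacobiPoly_starOffDiag {k : ℕ} (hk : k ≤ m) :
    jacobiPoly (alpha μ) (fun j => starOffDiag μ m j ^ 2) k = orthoPoly μ k := by
  rw [orthoPoly_eq_jacobiPoly hint hsupp]
  exact jacobiPoly_congr _ (fun j hj => starOffDiag_sq_of_ne hint hsupp m hj.ne) hk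

theorem starNode_strictMono : StrictMono (starNode μ m) :=
  (Tuple.monotone_sort _).strictMono_of_injective
    ((tridiag_eigenvalues_injective (fun k _ => starOffDiag_ne_zero hint hsupp m (k + 1)) _).comp
      (Equiv.injective _))

/-- Both are monic of degree `m + 1` and vanish at the `m + 1` distinct nodes. -/
theorem starPoly_eq_jacobiPoly : starPoly μ m =
    jacobiPoly (alpha μ) (fun j => starOffDiag μ m j ^ 2) (m + 1) := by
  have hinj := (starNode_strictMono hint hsupp m).injective
  have hN : starPoly μ m = Lagrange.nodal Finset.univ (starNode μ m) := rfl
  obtain ⟨hm, hd⟩ :=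
    jacobiPoly_monic_natDegree (alpha μ) (fun j => starOffDiag μ m j ^ 2) (m + 1)
  have e : (starPoly μ m).degree = (m + 1 : ℕ) := by
    rw [hN, Lagrange.degree_nodal]; simp
  refine Polynomial.eq_of_degree_sub_lt_of_eval_index_eq Finset.univ (hinj.injOn) ?_ fun k _ => ?_
  · have hM : (starPoly μ m).Monic := Lagrange.nodal_monic
    have := degree_sub_lt_left (e.trans (by rw [degree_eq_natDegree hm.ne_zero, hd])) hM.ne_zero
      (hM.leadingCoeff.trans hm.leadingCoeff.symm)
    rwa [Finset.card_fin, ← e]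
  · obtain ⟨v, hv⟩ := exists_isUnitEigenvector μ m k
    rw [jacobiPoly_eval_eigenvalue (fun k _ => starOffDiag_ne_zero hint hsupp m (k + 1)) hv.1
      hv.ne_zero, hN, Lagrange.eval_nodal_at_node (Finset.mem_univ k)]

/-- Only the last factor differs from the product `β_0 ⋯ β_m = ‖p_m‖²`; `m ≥ 1` ensures that it
occurs. -/
theorem beta_mul_prod_starOffDiag (hm : 1 ≤ m) :
    beta μ 0 * ∏ j ∈ Finset.range m, starOffDiag μ m (j + 1) ^ 2 =
      (beta μ m + beta μ (m + 1)) / beta μ m * polyInner μ (orthoPoly μ m) (orthoPoly μ m) := by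
  obtain ⟨n, rfl⟩ : ∃ n, m = n + 1 := ⟨m - 1, by omega⟩
  rw [← prod_beta hint hsupp, Finset.prod_range_succ, Finset.prod_range_succ,
    starOffDiag_sq_self hint hsupp,
    Finset.prod_congr rfl fun j hj => starOffDiag_sq_of_ne hint hsupp (n + 1) (k := j + 1) (by
      have := Finset.mem_range.1 hj
      omega)]
  have := (beta_pos hint hsupp (n + 1)).ne'
  field_simp

omit hint hsupp in
theorem derivative_qPoly_eval_starNode (k : Fin (m + 1)) :
    (qPoly μ m).derivative.eval (starNode μ m k) =
      (starPoly μ m).derivative.eval (starNode μ m k) *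
        (orthoPoly μ m).eval (starNode μ m k) := by
  have : (starPoly μ m).eval (starNode μ m k) = 0 :=
    Lagrange.eval_nodal_at_node (Finset.mem_univ k)
  simp [qPoly, derivative_mul, this, mul_comm]

variable {m} {v : Fin (m + 1) → Fin (m + 1) → ℝ}
  (hv : ∀ k, IsUnitEigenvector (Jstar μ m) (starNode μ m k) (v k))

theorem starWeight_pos {k : Fin (m + 1)} {u : Fin (m + 1) → ℝ}
    (hu : IsUnitEigenvector (Jstar μ m) (starNode μ m k) u) : 0 < starWeight μ u :=
  mul_pos (beta_pos hint hsupp 0) (sq_pos_of_ne_zero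
    (tridiag_eigenvector_zero_ne_zero (fun k _ => starOffDiag_ne_zero hint hsupp m (k + 1)) hu.1
      hu.ne_zero))

theorem starWeight_mul_derivative_qPoly (hm : 1 ≤ m) {k : Fin (m + 1)} {u : Fin (m + 1) → ℝ}
    (hu : IsUnitEigenvector (Jstar μ m) (starNode μ m k) u) :
    starWeight μ u * (qPoly μ m).derivative.eval (starNode μ m k) =
      (beta μ m + beta μ (m + 1)) / beta μ m * polyInner μ (orthoPoly μ m) (orthoPoly μ m) := by
  have h := hu.zero_sq_mul fun k _ => starOffDiag_ne_zero hint hsupp m (k + 1)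
  rw [← starPoly_eq_jacobiPoly hint hsupp, jacobiPoly_starOffDiag hint hsupp m le_rfl,
    ← derivative_qPoly_eval_starNode] at h
  rw [← beta_mul_prod_starOffDiag hint hsupp m hm, ← h, starWeight, mul_assoc]

/-- The product of this derivative with a positive weight is a positive constant. -/
theorem derivative_qPoly_eval_starNode_pos (hm : 1 ≤ m) (k : Fin (m + 1)) :
    0 < (qPoly μ m).derivative.eval (starNode μ m k) := by
  obtain ⟨u, hu⟩ := exists_isUnitEigenvector μ m k
  have hβ := beta_pos hint hsupp
  refine pos_of_mul_pos_right ?_ (starWeight_pos hint hsupp hu).le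
  rw [starWeight_mul_derivative_qPoly hint hsupp hm hu]
  exact mul_pos (div_pos (add_pos (hβ _) (hβ _)) (hβ _)) (polyInner_orthoPoly_pos hint hsupp m)

/-! ### Interlacing -/

omit hint hsupp in
/-- The derivative of a nodal polynomial has opposite signs at consecutive nodes. -/
theorem derivative_nodal_mul_neg {x : Fin (m + 1) → ℝ} (hx : StrictMono x) (k : Fin m) :
    (Lagrange.nodal Finset.univ x).derivative.eval (x k.castSucc) *
      (Lagrange.nodal Finset.univ x).derivative.eval (x k.succ) < 0 := by
  have hne : k.castSucc ≠ k.succ := k.castSucc_lt_succ.ne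
  rw [Lagrange.eval_nodal_derivative_eval_node_eq (Finset.mem_univ _),
    Lagrange.eval_nodal_derivative_eval_node_eq (Finset.mem_univ _), Lagrange.eval_nodal,
    Lagrange.eval_nodal,
    ← Finset.mul_prod_erase _ _ (Finset.mem_erase.2 ⟨hne.symm, Finset.mem_univ k.succ⟩),
    ← Finset.mul_prod_erase (Finset.univ.erase k.succ) _
      (Finset.mem_erase.2 ⟨hne, Finset.mem_univ k.castSucc⟩),
    Finset.erase_right_comm, mul_mul_mul_comm, ← Finset.prod_mul_distrib]
  -- The two mutual factors have opposite signs. Every other node lies on one side of both points,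
  -- so its two factors agree in sign.
  have h1 := hx k.castSucc_lt_succ
  refine mul_neg_of_neg_of_pos (mul_neg_of_neg_of_pos (by linarith) (by linarith))
    (Finset.prod_pos fun j hj => ?_)
  simp only [Finset.mem_erase, Finset.mem_univ, and_true] at hj
  rcases lt_or_gt_of_ne hj.1 with h | h
  · exact mul_pos (sub_pos.2 (hx h)) (sub_pos.2 (hx (h.trans k.castSucc_lt_succ)))
  · have h' : k.succ < j := lt_of_le_of_ne (Fin.castSucc_lt_iff_succ_le.1 h) (Ne.symm hj.2)
    exact mul_pos_of_neg_of_neg (sub_neg.2 (hx h)) (sub_neg.2 (hx h'))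

/-- At each node `p_m` has the sign of `p*'`, because `q' = p*' p_m > 0` there. -/
theorem orthoPoly_eval_starNode_mul_neg (hm : 1 ≤ m) (k : Fin m) :
    (orthoPoly μ m).eval (starNode μ m k.castSucc) *
      (orthoPoly μ m).eval (starNode μ m k.succ) < 0 := by
  have h1 := derivative_qPoly_eval_starNode_pos hint hsupp hm k.castSucc
  have h2 := derivative_qPoly_eval_starNode_pos hint hsupp hm k.succ
  have h3 : (starPoly μ m).derivative.eval (starNode μ m k.castSucc) *
      (starPoly μ m).derivative.eval (starNode μ m k.succ) < 0 :=
    derivative_nodal_mul_neg (starNode_strictMono hint hsupp m) k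
  rw [derivative_qPoly_eval_starNode] at h1 h2
  have h4 := mul_pos h1 h2
  rw [mul_mul_mul_comm] at h4
  exact neg_of_mul_pos_right h4 h3.le

omit hint hsupp in
/-- The intermediate value theorem for a polynomial changing sign. -/
theorem exists_isRoot_of_mul_neg {p : ℝ[X]} {s t : ℝ} (hst : s < t)
    (h : p.eval s * p.eval t < 0) : ∃ x, s < x ∧ x < t ∧ p.IsRoot x := by
  rcases mul_neg_iff.1 h with ⟨h1, h2⟩ | ⟨h1, h2⟩
  · obtain ⟨x, hx, h0⟩ := intermediate_value_Ioo' hst.le p.continuousOn ⟨h2, h1⟩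
    exact ⟨x, hx.1, hx.2, h0⟩
  · obtain ⟨x, hx, h0⟩ := intermediate_value_Ioo hst.le p.continuousOn ⟨h1, h2⟩
    exact ⟨x, hx.1, hx.2, h0⟩

omit hint hsupp in
theorem range_eq_setOf_isRoot {p : ℝ[X]} (hp : p ≠ 0) {n : ℕ} (hd : p.natDegree = n)
    {x : Fin n → ℝ} (hx : Function.Injective x) (h : ∀ k, p.IsRoot (x k)) :
    Set.range x = {t : ℝ | p.IsRoot t} := by
  classical
  have hsub : Finset.univ.image x ⊆ p.roots.toFinset := by
    intro t ht
    obtain ⟨k, -, rfl⟩ := Finset.mem_image.1 ht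
    simpa [hp] using h k
  have hcard : p.roots.toFinset.card ≤ (Finset.univ.image x).card := by
    rw [Finset.card_image_of_injective _ hx, Finset.card_fin, ← hd]
    exact (Multiset.toFinset_card_le _).trans p.card_roots'
  have he := Finset.eq_of_subset_of_card_le hsub hcard
  ext t
  have := congrArg (t ∈ ·) he
  simpa [hp] using this

theorem exists_orthoPoly_zeros_interlacing (hm : 1 ≤ m) :
    ∃ x : Fin m → ℝ, StrictMono x ∧ Set.range x = {t : ℝ | (orthoPoly μ m).IsRoot t} ∧
      ∀ k : Fin m, starNode μ m k.castSucc < x k ∧ x k < starNode μ m k.succ := by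
  have hmono := starNode_strictMono hint hsupp m
  choose x h1 h2 h3 using fun k : Fin m => exists_isRoot_of_mul_neg
    (hmono k.castSucc_lt_succ) (orthoPoly_eval_starNode_mul_neg hint hsupp hm k)
  have hx : StrictMono x := fun k l hkl =>
    (h2 k).trans ((hmono.monotone (Fin.succ_le_castSucc_iff.2 hkl)).trans_lt (h1 l))
  obtain ⟨hM, hd⟩ := orthoPoly_monic_natDegree μ m
  exact ⟨x, hx, range_eq_setOf_isRoot hM.ne_zero hd hx.injective h3, fun k => ⟨h1 k, h2 k⟩⟩

/-! ### Degree of exactness -/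

/-- A quadrature rule as a linear map on polynomials. -/
noncomputable def quadRuleMap {n : ℕ} (x w : Fin n → ℝ) : ℝ[X] →ₗ[ℝ] ℝ :=
  ∑ k, w k • Polynomial.leval (x k)

omit hint hsupp in
theorem quadRuleMap_apply {n : ℕ} (x w : Fin n → ℝ) (f : ℝ[X]) :
    quadRuleMap x w f = quadRule x w fun t => f.eval t := by
  simp [quadRuleMap, quadRule, LinearMap.sum_apply]

-- As `v_{k,0} p_l(x*_k)` is a multiple of `v_{k,l}`, the rule turns into a dual orthogonality sum.
-- The case `i = j = m ≥ 1` must be excluded: the enlarged off-diagonal entry scales the value by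
-- `(β_m + β_{m+1}) / β_m`.
include hv in
theorem quadRuleMap_orthoPoly_mul {i j : ℕ} (hi : i ≤ m) (hj : j ≤ m) (hij : i ≠ j ∨ i = 0) :
    quadRuleMap (starNode μ m) (fun k => starWeight μ (v k)) (orthoPoly μ i * orthoPoly μ j) =
      polyInner μ (orthoPoly μ i) (orthoPoly μ j) := by
  have hcoord : ∀ k, ∀ l (hl : l ≤ m), v k 0 * (orthoPoly μ l).eval (starNode μ m k) =
      v k ⟨l, Nat.lt_succ_of_le hl⟩ * ∏ r ∈ Finset.range l, starOffDiag μ m (r + 1) := by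
    intro k l hl
    have h := tridiag_eigenvector_apply (b := starOffDiag μ m) (hv k).1 ⟨l, Nat.lt_succ_of_le hl⟩
    rw [jacobiPoly_starOffDiag hint hsupp m hl] at h
    exact h.symm
  have h : quadRuleMap (starNode μ m) (fun k => starWeight μ (v k))
      (orthoPoly μ i * orthoPoly μ j) = beta μ 0 *
        ((∏ r ∈ Finset.range i, starOffDiag μ m (r + 1)) *
          ∏ r ∈ Finset.range j, starOffDiag μ m (r + 1)) *
        ∑ k, v k ⟨i, Nat.lt_succ_of_le hi⟩ * v k ⟨j, Nat.lt_succ_of_le hj⟩ := by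
    rw [quadRuleMap_apply, quadRule, Finset.mul_sum]
    refine Finset.sum_congr rfl fun k _ => ?_
    rw [eval_mul, starWeight]
    linear_combination beta μ 0 * v k 0 * (orthoPoly μ j).eval (starNode μ m k) * hcoord k i hi +
      beta μ 0 * v k ⟨i, Nat.lt_succ_of_le hi⟩ *
        (∏ r ∈ Finset.range i, starOffDiag μ m (r + 1)) * hcoord k j hj
  rw [h, sum_eigenvector_mul (tridiag_isHermitian _ _ _)
    (starNode_strictMono hint hsupp m).injective hv]
  by_cases e : i = j
  · subst e
    obtain rfl : i = 0 := by tauto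
    simp [beta]
  · rw [if_neg (by simpa using e), mul_zero, polyInner_orthoPoly_of_ne hint hsupp e]

include hv in
theorem hasExactness_star (hm : 1 ≤ m) :
    HasExactness μ (quadRule (starNode μ m) fun k => starWeight μ (v k)) (2 * m - 1) := by
  intro f hf
  let E := integralMap hint - quadRuleMap (starNode μ m) fun k => starWeight μ (v k)
  have hE : ∀ i j, i ≤ m → j ≤ m → (i ≠ j ∨ i = 0) → E (orthoPoly μ i * orthoPoly μ j) = 0 := by
    intro i j hi hj hij
    rw [LinearMap.sub_apply, integralMap_mul, quadRuleMap_orthoPoly_mul hint hsupp hv hi hj hij,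
      sub_self]
  obtain ⟨hM, hd⟩ := orthoPoly_monic_natDegree μ m
  suffices h : E f = 0 by
    rw [LinearMap.sub_apply, quadRuleMap_apply] at h
    exact sub_eq_zero.1 h
  rw [← modByMonic_add_div f (orthoPoly μ m), map_add]
  have h1 : E (f %ₘ orthoPoly μ m) = 0 := by
    refine linearMap_eq_zero_of_degree_lt (μ := μ) (n := m) E (fun j hj => ?_) ?_
    -- Here `p_j` is read as `p_0 p_j`; this is why the case `i = j = 0` was kept.
    · simpa [orthoPoly_zero] using hE 0 j (by omega) hj.le (Or.inr rfl)
    · have := degree_modByMonic_lt f hM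
      rwa [degree_eq_natDegree hM.ne_zero, hd] at this
  have h2 : E (orthoPoly μ m * (f /ₘ orthoPoly μ m)) = 0 := by
    refine linearMap_eq_zero_of_degree_lt (μ := μ) (n := m)
      (E.comp (LinearMap.mulLeft ℝ (orthoPoly μ m))) (fun j hj => ?_) ?_
    · exact hE m j le_rfl hj.le (Or.inl hj.ne')
    · refine degree_le_natDegree.trans_lt ?_
      rw [natDegree_divByMonic f hM, hd]
      -- The quotient has degree at most `(2m - 1) - m = m - 1`.
      exact_mod_cast (by omega : f.natDegree - m < m)
  rw [h1, h2, add_zero]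

end Star

end AveragedGauss

theorem theorem2p1 (μ : MeasureTheory.Measure ℝ)
    (hint : ∀ n : ℕ, MeasureTheory.Integrable (fun x : ℝ => x ^ n) μ)
    (hsupp : μ.support.Infinite) (m : ℕ) (hm : 1 ≤ m)
    (v : Fin (m + 1) → Fin (m + 1) → ℝ)
    (hv : ∀ k, AveragedGauss.IsUnitEigenvector (AveragedGauss.Jstar μ m)
      (AveragedGauss.starNode μ m k) (v k)) :
    AveragedGauss.HasExactness μ
        (AveragedGauss.quadRule (AveragedGauss.starNode μ m)
          fun k => AveragedGauss.starWeight μ (v k)) (2 * m - 1) ∧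
      (∃ x : Fin m → ℝ, StrictMono x ∧
        Set.range x = {t : ℝ | (AveragedGauss.orthoPoly μ m).IsRoot t} ∧
        ∀ k : Fin m, AveragedGauss.starNode μ m k.castSucc < x k ∧
          x k < AveragedGauss.starNode μ m k.succ) ∧
      ∀ k : Fin (m + 1),
        AveragedGauss.starWeight μ (v k) =
            (AveragedGauss.beta μ m + AveragedGauss.beta μ (m + 1)) / AveragedGauss.beta μ m *
              (AveragedGauss.polyNorm μ (AveragedGauss.orthoPoly μ m) ^ 2 /
                (AveragedGauss.qPoly μ m).derivative.eval (AveragedGauss.starNode μ m k)) ∧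
          0 < AveragedGauss.starWeight μ (v k) := by
  refine ⟨AveragedGauss.hasExactness_star hint hsupp hv hm,
    AveragedGauss.exists_orthoPoly_zeros_interlacing hint hsupp hm,
    fun k => ⟨?_, AveragedGauss.starWeight_pos hint hsupp (hv k)⟩⟩
  rw [AveragedGauss.polyNorm,
    Real.sq_sqrt (AveragedGauss.polyInner_orthoPoly_pos hint hsupp m).le, ← mul_div_assoc,
    eq_div_iff (AveragedGauss.derivative_qPoly_eval_starNode_pos hint hsupp hm k).ne']
  exact AveragedGauss.starWeight_mul_derivative_qPoly hint hsupp hm (hv k)
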